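/- Let $G$ be a finite simple graph on a vertex set $V$, $|V|=n$. The vertex packing polytope $VP(G)\subseteq\mathbb{R}^V$ is the convex hull of the characteristic vectors of the independent sets of $G$. For a probability density $P=(p_v)_{v\in V}$ on $V$, the entropy of $G$ with respect to $P$ is $$H(G,P)=\min_{a\in VP(G)}\ \sum_{v\in V}p_v\log_2\frac{1}{a_v},$$ where $\log_2(1/0)=+\infty$ and $0\cdot(+\infty)=0$. The graph $G$ is called symmetric with respect to graph entropy if the uniform density $U=(1/n,\dots,1/n)$ maximizes the entropy of $G$, that is, $H(G,P)\le H(G,U)$ for every probability density $P$ on $V$. **Corollary.** Let $G_1$ be a finite simple cubic (that is, $3$-regular) graph, not necessarily connected, none of whose edges is a bridge. Then the line graph $L(G_1)$, whose vertices are the edges of $G_1$, two distinct ones being adjacent when they share an endpoint, is symmetric with respect to graph entropy. -/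

import Mathlib

noncomputable section

namespace GraphEntropy

/-- The vertex packing polytope `VP(G)`: the convex hull in `ℝ^V` of the characteristic vectors
of the independent sets of `G`. -/
def vertexPackingPolytope {V : Type*} (G : SimpleGraph V) : Set (V → ℝ) :=
  convexHull ℝ {x | ∃ S : Set V, G.IsIndepSet S ∧ x = S.indicator 1}

/-- `log₂ (1 / x)` for `x ≥ 0`, as an extended real number, with value `+∞` at `x = 0`. -/
def logInv (x : ℝ) : EReal :=
  if x = 0 then ⊤ else ((Real.logb 2 (1 / x) : ℝ) : EReal)

/-- The entropy `H(G, P)` of the graph `G` with respect to the probability density `p` on its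
vertices: the minimum over `a ∈ VP(G)` of `∑ v, p v * log₂ (1 / a v)`. The product is that of
`EReal`, so that `0 * ∞ = 0` and `c * ∞ = ∞` for `c > 0`. -/
def entropy {V : Type*} [Fintype V] (G : SimpleGraph V) (p : V → ℝ) : EReal :=
  ⨅ a ∈ vertexPackingPolytope G, ∑ v, (p v : EReal) * logInv (a v)

/-- The uniform density on `V`. -/
def uniform (V : Type*) [Fintype V] : V → ℝ := fun _ => 1 / (Fintype.card V : ℝ)

/-- `G` is symmetric with respect to graph entropy: among all probability densities on the
vertices of `G`, the uniform one maximizes the entropy of `G`. -/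
def IsSymmetric {V : Type*} [Fintype V] (G : SimpleGraph V) : Prop :=
  ∀ p ∈ stdSimplex ℝ V, entropy G p ≤ entropy G (uniform V)

/-- No edge of `G` is a bridge. -/
def IsBridgeless {V : Type*} (G : SimpleGraph V) : Prop :=
  ∀ e ∈ G.edgeSet, ¬ G.IsBridge e

end GraphEntropy

end

/-!
If the vector with all coordinates `1 / 3` lies in the vertex packing polytope of the line graph,
that is, in the matching polytope of `G`, then `H(L(G), P) ≤ log₂ 3` for every density `P`. On the
other hand, a point of the matching polytope has total weight at most `1` at each vertex, so in a
cubic graph its mean coordinate is at most `1 / 3`, and concavity of the logarithm gives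
`H(L(G), U) ≥ log₂ 3`. These are `entropy_le_logb_three` and `logb_three_le_entropy_uniform`.

It remains to write the constant vector `1 / 3` as a convex combination of perfect matchings. By
parity and the absence of bridges every odd cut of `G` has at least three edges, so the vector
satisfies Edmonds' inequalities (`isFractionalMatching_third`), and Edmonds' perfect matching
theorem (`IsFractionalMatching.isMatchingCombination`) applies. That theorem is proved here by
induction. Tutte's theorem yields a perfect matching in the support of the weights `f`, and as large
a multiple of it as Edmonds' inequalities permit is subtracted. Either the support shrinks, or a
nontrivial odd cut becomes tight. In the latter case each side of the cut is contracted in turn to a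
single vertex, and the two decompositions obtained by induction are glued together: matchings of the
two contractions are paired by a coupling in which the pair of endpoints of the crossing edge is
distributed according to `f` (`exists_coupling`, `IsMatchingCombination.of_contract`).

Edge weights are symmetric functions `V → V → ℝ` considered on a finite set `S` of vertices, so that
contracted graphs live on subsets of the same type.
-/

open Finset

namespace GraphEntropy

/-! ### Fractional perfect matchings and their contractions -/

/-- The total weight `f` carried by the pairs with first entry in `A` and second entry in `B`. -/
def cutWeight {V : Type*} (f : V → V → ℝ) (A B : Finset V) : ℝ :=
  ∑ u ∈ A, ∑ v ∈ B, f u v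

/-- Edmonds' inequalities for the perfect matching polytope of the complete graph on `S`, for edge
weights given as a symmetric function of two vertices. Loops carry no weight: this is the cut
condition at a singleton together with the condition at that vertex. -/
structure IsFractionalMatching {V : Type*} [DecidableEq V] (S : Finset V) (f : V → V → ℝ) :
    Prop where
  nonneg : ∀ u v, 0 ≤ f u v
  symm : ∀ u v, f u v = f v u
  row : ∀ u ∈ S, ∑ v ∈ S, f u v = 1
  cut : ∀ W ⊆ S, Odd #W → 1 ≤ cutWeight f W (S \ W)

/-- A perfect matching of the complete graph on `S`, given as the map sending a vertex to its
partner. Its values outside `S` are irrelevant. -/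
def IsMatchingMap {V : Type*} (S : Finset V) (σ : V → V) : Prop :=
  ∀ v ∈ S, σ v ∈ S ∧ σ v ≠ v ∧ σ (σ v) = v

/-- On `S`, the weights `f` are a convex combination of perfect matchings. -/
def IsMatchingCombination {V : Type*} [DecidableEq V] (S : Finset V) (f : V → V → ℝ) : Prop :=
  ∃ (ι : Type) (_ : Fintype ι) (c : ι → ℝ) (σ : ι → V → V),
    (∀ i, 0 ≤ c i) ∧ ∑ i, c i = 1 ∧ (∀ i, IsMatchingMap S (σ i)) ∧
      ∀ u ∈ S, ∀ v ∈ S, ∑ i, c i * (if σ i u = v then 1 else 0) = f u v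

lemma cutWeight_comm {V : Type*} {f : V → V → ℝ} (hf : ∀ u v, f u v = f v u) (A B : Finset V) :
    cutWeight f A B = cutWeight f B A := by
  unfold cutWeight
  rw [sum_comm]
  exact sum_congr rfl fun u _ => sum_congr rfl fun v _ => hf v u

lemma IsMatchingMap.apply_eq_iff {V : Type*} {A : Finset V} {u v : V} {σ : V → V}
    (hσ : IsMatchingMap A σ) (hu : u ∈ A) (hv : v ∈ A) : σ u = v ↔ σ v = u := by
  constructor
  · rintro rfl; exact (hσ u hu).2.2
  · rintro rfl; exact (hσ v hv).2.2

section

variable {V : Type*} [DecidableEq V] {S U : Finset V} {f : V → V → ℝ}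

lemma IsFractionalMatching.even_card (hf : IsFractionalMatching S f) : Even #S := by
  by_contra h
  have := hf.cut S subset_rfl (Nat.not_even_iff_odd.mp h)
  simp [cutWeight] at this
  linarith

lemma IsFractionalMatching.loop_eq_zero (hf : IsFractionalMatching S f) {v : V} (hv : v ∈ S) :
    f v v = 0 := by
  have h1 := hf.cut {v} (by simpa using hv) (by simp)
  have h2 := hf.row v hv
  rw [← add_sum_erase S _ hv] at h2
  rw [cutWeight, sum_singleton, sdiff_singleton_eq_erase] at h1
  have := hf.nonneg v v
  linarith

/-- Two finite weighted families whose weight is distributed over `A` and over `B` as the two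
marginals of `F` have a coupling whose joint distribution is `F`. -/
lemma exists_coupling {ι κ : Type*} [Fintype ι] [Fintype κ] {A B : Finset V} {F : V → V → ℝ}
    (hF : ∀ u v, 0 ≤ F u v) {c : ι → ℝ} {d : κ → ℝ} (hc : ∀ i, 0 ≤ c i) (hd : ∀ j, 0 ≤ d j)
    {a : ι → V} {b : κ → V} (ha : ∀ i, a i ∈ A) (hb : ∀ j, b j ∈ B)
    (hcA : ∀ u ∈ A, ∑ i, c i * (if a i = u then 1 else 0) = ∑ v ∈ B, F u v)
    (hdB : ∀ v ∈ B, ∑ j, d j * (if b j = v then 1 else 0) = ∑ u ∈ A, F u v) :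
    ∃ e : ι → κ → ℝ, (∀ i j, 0 ≤ e i j) ∧ (∀ i, ∑ j, e i j = c i) ∧ (∀ j, ∑ i, e i j = d j) ∧
      ∀ u ∈ A, ∀ v ∈ B,
        ∑ i, ∑ j, e i j * ((if a i = u then 1 else 0) * (if b j = v then 1 else 0)) = F u v := by
  set g : V → ℝ := fun u => ∑ v ∈ B, F u v with hg
  set h : V → ℝ := fun v => ∑ u ∈ A, F u v with hh
  have hg0 : ∀ u, 0 ≤ g u := fun u => sum_nonneg fun v _ => hF u v
  have hh0 : ∀ v, 0 ≤ h v := fun v => sum_nonneg fun u _ => hF u v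
  have hFg : ∀ u, ∀ v ∈ B, g u = 0 → F u v = 0 := fun u v hv hz =>
    (sum_eq_zero_iff_of_nonneg fun w _ => hF u w).mp hz v hv
  have hFh : ∀ u ∈ A, ∀ v, h v = 0 → F u v = 0 := fun u hu v hz =>
    (sum_eq_zero_iff_of_nonneg fun w _ => hF w v).mp hz u hu
  have hcg : ∀ i, g (a i) = 0 → c i = 0 := by
    intro i hz
    have h1 := hcA (a i) (ha i)
    rw [show ∑ v ∈ B, F (a i) v = 0 from hz] at h1
    have := (sum_eq_zero_iff_of_nonneg (fun k _ => mul_nonneg (hc k) (by split_ifs <;> simp))).mp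
      h1 i (mem_univ i)
    simpa using this
  have hdh : ∀ j, h (b j) = 0 → d j = 0 := by
    intro j hz
    have h1 := hdB (b j) (hb j)
    rw [show ∑ u ∈ A, F u (b j) = 0 from hz] at h1
    have := (sum_eq_zero_iff_of_nonneg (fun k _ => mul_nonneg (hd k) (by split_ifs <;> simp))).mp
      h1 j (mem_univ j)
    simpa using this
  -- Averages over a family only depend on its distribution.
  have hpushB : ∀ φ : V → ℝ, ∑ j, d j * φ (b j) = ∑ v ∈ B, h v * φ v := by
    intro φ
    have : ∀ v ∈ B, h v * φ v = ∑ j, d j * (if b j = v then 1 else 0) * φ v := by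
      intro v hv
      rw [← sum_mul, hdB v hv]
    rw [sum_congr rfl this, sum_comm]
    refine sum_congr rfl fun j _ => ?_
    simp [hb j]
  have hpushA : ∀ φ : V → ℝ, ∑ i, c i * φ (a i) = ∑ u ∈ A, g u * φ u := by
    intro φ
    have : ∀ u ∈ A, g u * φ u = ∑ i, c i * (if a i = u then 1 else 0) * φ u := by
      intro u hu
      rw [← sum_mul, hcA u hu]
    rw [sum_congr rfl this, sum_comm]
    refine sum_congr rfl fun i _ => ?_
    simp [ha i]
  -- Given the pair `(u, v)` drawn from `F`, the indices `i` and `j` are drawn independently with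
  -- conditional weights `c i / g u` and `d j / h v`. Where `g` or `h` vanishes the quotient is `0`,
  -- and so is the required weight.
  refine ⟨fun i j => c i * d j * (F (a i) (b j) / (g (a i) * h (b j))), ?_, ?_, ?_, ?_⟩
  · intro i j
    have := hc i; have := hd j; have := hF (a i) (b j)
    have := hg0 (a i); have := hh0 (b j)
    positivity
  · intro i
    have h1 := hpushB fun v => F (a i) v / (g (a i) * h v)
    calc _ = c i * ∑ j, d j * (F (a i) (b j) / (g (a i) * h (b j))) := by
          rw [mul_sum]; exact sum_congr rfl fun j _ => by ring
      _ = c i * ∑ v ∈ B, F (a i) v / g (a i) := by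
          rw [h1]; congr 1
          refine sum_congr rfl fun v hv => ?_
          by_cases hz : h v = 0
          · simp [hFh _ (ha i) v hz]
          · by_cases hz' : g (a i) = 0
            · simp [hz']
            · field_simp
      _ = c i := by
          rw [← sum_div]
          by_cases hz : g (a i) = 0
          · simp [hcg i hz]
          · rw [show ∑ v ∈ B, F (a i) v = g (a i) from rfl, div_self hz, mul_one]
  · intro j
    have h1 := hpushA fun u => F u (b j) / (g u * h (b j))
    calc _ = d j * ∑ i, c i * (F (a i) (b j) / (g (a i) * h (b j))) := by
          rw [mul_sum]; exact sum_congr rfl fun j _ => by ring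
      _ = d j * ∑ u ∈ A, F u (b j) / h (b j) := by
          rw [h1]; congr 1
          refine sum_congr rfl fun u hu => ?_
          by_cases hz : g u = 0
          · simp [hFg u _ (hb j) hz]
          · by_cases hz' : h (b j) = 0
            · simp [hz']
            · field_simp
      _ = d j := by
          rw [← sum_div]
          by_cases hz : h (b j) = 0
          · simp [hdh j hz]
          · rw [show ∑ u ∈ A, F u (b j) = h (b j) from rfl, div_self hz, mul_one]
  · intro u hu v hv
    have h1 : ∀ i j, c i * d j * (F (a i) (b j) / (g (a i) * h (b j))) *
        ((if a i = u then 1 else 0) * (if b j = v then 1 else 0)) =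
        (c i * (if a i = u then 1 else 0)) * (d j * (if b j = v then 1 else 0)) *
          (F u v / (g u * h v)) := by
      intro i j
      split_ifs with h1 h2
      · subst h1 h2; ring
      all_goals simp
    simp_rw [h1]
    have h2 : ∀ i, ∑ j, (c i * (if a i = u then 1 else 0)) * (d j * (if b j = v then 1 else 0)) *
          (F u v / (g u * h v)) = (c i * (if a i = u then 1 else 0)) *
          (h v * (F u v / (g u * h v))) := by
      intro i
      rw [← sum_mul, ← mul_sum, hdB v hv, mul_assoc]
    rw [sum_congr rfl fun i _ => h2 i, ← sum_mul, hcA u hu]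
    change g u * (h v * (F u v / (g u * h v))) = F u v
    by_cases hz : g u = 0
    · simp [hFg u v hv hz, hz]
    · by_cases hz' : h v = 0
      · simp [hFh u hu v hz', hz']
      · field_simp

/-- The weights on `insert r U` obtained from `f` by contracting `S \ U` to the vertex `r`. -/
def contract (S U : Finset V) (r : V) (f : V → V → ℝ) (u v : V) : ℝ :=
  if u ∈ U then
    if v ∈ U then f u v else if v = r then ∑ x ∈ S \ U, f u x else 0
  else if u = r ∧ v ∈ U then ∑ x ∈ S \ U, f v x else 0

lemma contract_symm (hf : ∀ u v, f u v = f v u) (r : V) (u v : V) :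
    contract S U r f u v = contract S U r f v u := by
  unfold contract
  by_cases hu : u ∈ U <;> by_cases hv : v ∈ U <;> simp [hu, hv, hf u v]

/-- Contracting the far side of a tight odd cut preserves Edmonds' inequalities. -/
lemma IsFractionalMatching.contract (hf : IsFractionalMatching S f) (hU : U ⊆ S) (hodd : Odd #U)
    (htight : cutWeight f U (S \ U) = 1) {r : V} (hr : r ∈ S \ U) :
    IsFractionalMatching (insert r U) (contract S U r f) := by
  have hrU : r ∉ U := (mem_sdiff.mp hr).2
  have hsymm := contract_symm (S := S) (U := U) hf.symm r
  have hnear : ∀ W ⊆ U, Odd #W → 1 ≤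
      cutWeight (GraphEntropy.contract S U r f) W (insert r U \ W) := by
    intro W hW hWo
    refine (hf.cut W (hW.trans hU) hWo).trans_eq ?_
    unfold cutWeight
    refine sum_congr rfl fun u hu => ?_
    have huU := hW hu
    have h1 : insert r U \ W = insert r (U \ W) := insert_sdiff_of_notMem _ fun h => hrU (hW h)
    have h2 : S \ W = (U \ W) ∪ (S \ U) := by
      ext x
      have := @hU x; have := @hW x
      simp only [mem_sdiff, mem_union]; tauto
    have h3 : Disjoint (U \ W) (S \ U) :=
      disjoint_left.mpr fun x hx hx' => (mem_sdiff.mp hx').2 (mem_sdiff.mp hx).1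
    rw [h1, h2, sum_union h3, sum_insert (by simp [hrU]), add_comm]
    congr 1
    · simp [GraphEntropy.contract, huU, hrU]
    · refine sum_congr rfl fun x hx => ?_
      simp [GraphEntropy.contract, huU, (mem_sdiff.mp hx).1]
  refine ⟨?_, hsymm, ?_, ?_⟩
  · intro u v
    unfold GraphEntropy.contract
    split_ifs
    · exact hf.nonneg _ _
    · exact sum_nonneg fun _ _ => hf.nonneg _ _
    · exact le_rfl
    · exact sum_nonneg fun _ _ => hf.nonneg _ _
    · exact le_rfl
  · intro u hu
    rw [sum_insert hrU]
    rcases mem_insert.mp hu with rfl | hu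
    · rw [← htight, cutWeight]
      simp only [GraphEntropy.contract, hrU, if_false, and_false, true_and, zero_add]
      exact sum_congr rfl fun x hx => by simp [hx]
    · rw [← hf.row u (hU hu), ← sum_sdiff hU]
      congr 1
      · simp [GraphEntropy.contract, hu, hrU]
      · exact sum_congr rfl fun x hx => by simp [GraphEntropy.contract, hu, hx]
  · intro W hW hWo
    by_cases hrW : r ∈ W
    · -- The complement of `W` is odd and avoids `r`, and it defines the same cut.
      have hsub : insert r U \ W ⊆ U := by
        intro x hx
        rcases mem_insert.mp (mem_sdiff.mp hx).1 with rfl | h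
        · exact absurd hrW (mem_sdiff.mp hx).2
        · exact h
      have hcard := card_sdiff_add_card_eq_card hW
      rw [card_insert_of_notMem hrU] at hcard
      have hWo' : Odd #(insert r U \ W) := by
        rcases hodd with ⟨a, ha⟩; rcases hWo with ⟨b, hb⟩
        exact ⟨a - b, by omega⟩
      have := hnear _ hsub hWo'
      rwa [Finset.sdiff_sdiff_eq_self hW, cutWeight_comm hsymm] at this
    · refine hnear W (fun x hx => ?_) hWo
      rcases mem_insert.mp (hW hx) with rfl | h
      · exact absurd hx hrW
      · exact h

/-- The matching of `S` obtained from a matching `σ` of `insert r U` and a matching `τ` of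
`insert s (S \ U)` by joining the partner of `r` to the partner of `s`. -/
def glue (U : Finset V) (r s : V) (σ τ : V → V) (v : V) : V :=
  if v ∈ U then if σ v = r then τ s else σ v else if τ v = s then σ r else τ v

lemma IsMatchingMap.partner_mem {A : Finset V} {r : V} {σ : V → V}
    (hσ : IsMatchingMap (insert r A) σ) : σ r ∈ A := by
  obtain ⟨h1, h2, -⟩ := hσ r (mem_insert_self _ _)
  exact (mem_insert.mp h1).resolve_left h2

lemma IsMatchingMap.mem_of_ne {A : Finset V} {r v : V} {σ : V → V}
    (hσ : IsMatchingMap (insert r A) σ) (hv : v ∈ A) (h : σ v ≠ r) : σ v ∈ A :=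
  (mem_insert.mp (hσ v (mem_insert_of_mem hv)).1).resolve_left h

lemma IsMatchingMap.glue (hU : U ⊆ S) {r s : V} (hr : r ∈ S \ U) (hs : s ∈ U) {σ τ : V → V}
    (hσ : IsMatchingMap (insert r U) σ) (hτ : IsMatchingMap (insert s (S \ U)) τ) :
    IsMatchingMap S (glue U r s σ τ) := by
  have hσr := hσ.partner_mem
  have hτs := hτ.partner_mem
  have hrU := (mem_sdiff.mp hr).2
  intro v hv
  by_cases hvU : v ∈ U
  · have hv' := hσ v (mem_insert_of_mem hvU)
    by_cases h : σ v = r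
    · have h' : σ r = v := h ▸ hv'.2.2
      have hg : GraphEntropy.glue U r s σ τ v = τ s := by simp [GraphEntropy.glue, hvU, h]
      rw [hg]
      refine ⟨(mem_sdiff.mp hτs).1, fun e => (mem_sdiff.mp hτs).2 (e ▸ hvU), ?_⟩
      simp [GraphEntropy.glue, (mem_sdiff.mp hτs).2, (hτ s (mem_insert_self _ _)).2.2, h']
    · have hm := hσ.mem_of_ne hvU h
      have hg : GraphEntropy.glue U r s σ τ v = σ v := by simp [GraphEntropy.glue, hvU, h]
      rw [hg]
      refine ⟨hU hm, hv'.2.1, ?_⟩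
      have : v ≠ r := fun e => hrU (e ▸ hvU)
      simp [GraphEntropy.glue, hm, hv'.2.2, this]
  · have hvS : v ∈ S \ U := mem_sdiff.mpr ⟨hv, hvU⟩
    have hv' := hτ v (mem_insert_of_mem hvS)
    by_cases h : τ v = s
    · have h' : τ s = v := h ▸ hv'.2.2
      have hg : GraphEntropy.glue U r s σ τ v = σ r := by simp [GraphEntropy.glue, hvU, h]
      rw [hg]
      refine ⟨hU hσr, fun e => hvU (e ▸ hσr), ?_⟩
      simp [GraphEntropy.glue, hσr, (hσ r (mem_insert_self _ _)).2.2, h']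
    · have hm := hτ.mem_of_ne hvS h
      have hg : GraphEntropy.glue U r s σ τ v = τ v := by simp [GraphEntropy.glue, hvU, h]
      rw [hg]
      refine ⟨(mem_sdiff.mp hm).1, hv'.2.1, ?_⟩
      have : v ≠ s := fun e => hvU (e ▸ hs)
      simp [GraphEntropy.glue, (mem_sdiff.mp hm).2, hv'.2.2, this]

/-- Decompositions of the two contractions along a cut, coupled by the edges in which they cross
the cut, glue to a decomposition of `f`. -/
lemma IsMatchingCombination.of_contract (hf : IsFractionalMatching S f) (hU : U ⊆ S) {r s : V}
    (hr : r ∈ S \ U) (hs : s ∈ U)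
    (h₁ : IsMatchingCombination (insert r U) (contract S U r f))
    (h₂ : IsMatchingCombination (insert s (S \ U)) (contract S (S \ U) s f)) :
    IsMatchingCombination S f := by
  obtain ⟨ι, _, c, σ, hc0, hc1, hσ, hcf⟩ := h₁
  obtain ⟨κ, _, d, τ, hd0, hd1, hτ, hdf⟩ := h₂
  have hrU := (mem_sdiff.mp hr).2
  have hSU : S \ (S \ U) = U := Finset.sdiff_sdiff_eq_self hU
  obtain ⟨e, he0, hec, hed, hef⟩ := exists_coupling (A := U) (B := S \ U) hf.nonneg hc0 hd0
    (a := fun i => σ i r) (b := fun j => τ j s)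
    (fun i => (hσ i).partner_mem) (fun j => (hτ j).partner_mem)
    (by
      intro u hu
      rw [hcf r (mem_insert_self _ _) u (mem_insert_of_mem hu)]
      simp [contract, hrU, hu])
    (by
      intro v hv
      rw [hdf s (mem_insert_self _ _) v (mem_insert_of_mem hv)]
      simp only [contract, hSU, hv, if_true, and_true]
      simp [hs, hf.symm v])
  have hcross : ∀ u ∈ U, ∀ v ∈ S \ U,
      ∑ p : ι × κ, e p.1 p.2 * (if glue U r s (σ p.1) (τ p.2) u = v then 1 else 0) = f u v := by
    intro u hu v hv
    rw [← hef u hu v hv, Fintype.sum_prod_type]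
    refine sum_congr rfl fun i _ => sum_congr rfl fun j _ => ?_
    have := (hσ i).apply_eq_iff (mem_insert_of_mem hu) (mem_insert_self r U)
    by_cases h : σ i r = u
    · simp [glue, hu, this.mpr h, h]
    · have h' : σ i u ≠ r := fun h' => h (this.mp h')
      have h'' : σ i u ≠ v := fun e => (mem_sdiff.mp hv).2 (e ▸ (hσ i).mem_of_ne hu h')
      simp [glue, hu, h, h', h'']
  have hmatch := fun i j => IsMatchingMap.glue hU hr hs (hσ i) (hτ j)
  refine ⟨ι × κ, inferInstance, fun p => e p.1 p.2, fun p => glue U r s (σ p.1) (τ p.2),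
    fun p => he0 _ _, ?_, fun p => hmatch _ _, ?_⟩
  · rw [Fintype.sum_prod_type, ← hc1]
    exact sum_congr rfl fun i _ => hec i
  · intro u hu v hv
    by_cases huU : u ∈ U <;> by_cases hvU : v ∈ U
    · have h1 := hcf u (mem_insert_of_mem huU) v (mem_insert_of_mem hvU)
      rw [show contract S U r f u v = f u v by simp [contract, huU, hvU]] at h1
      rw [← h1, Fintype.sum_prod_type]
      refine sum_congr rfl fun i _ => ?_
      rw [← hec i, sum_mul]
      refine sum_congr rfl fun j _ => ?_
      congr 2
      have hτs := (hτ j).partner_mem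
      by_cases h : σ i u = r
      · have h1 : τ j s ≠ v := fun e => (mem_sdiff.mp hτs).2 (e ▸ hvU)
        have h2 : r ≠ v := fun e => hrU (e ▸ hvU)
        simp [glue, huU, h, h1, h2]
      · simp [glue, huU, h]
    · exact hcross u huU v (mem_sdiff.mpr ⟨hv, hvU⟩)
    · rw [hf.symm, ← hcross v hvU u (mem_sdiff.mpr ⟨hu, huU⟩)]
      refine sum_congr rfl fun p _ => ?_
      simp only [(hmatch p.1 p.2).apply_eq_iff hu hv]
    · have hu' := mem_sdiff.mpr ⟨hu, huU⟩
      have hv' := mem_sdiff.mpr ⟨hv, hvU⟩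
      have h1 := hdf u (mem_insert_of_mem hu') v (mem_insert_of_mem hv')
      rw [show contract S (S \ U) s f u v = f u v by simp [contract, hu, hv, huU, hvU]] at h1
      rw [← h1, Fintype.sum_prod_type_right]
      refine sum_congr rfl fun j _ => ?_
      rw [← hed j, sum_mul]
      refine sum_congr rfl fun i _ => ?_
      congr 2
      have hσr := (hσ i).partner_mem
      by_cases h : τ j u = s
      · have h1 : σ i r ≠ v := fun e => hvU (e ▸ hσr)
        have h2 : s ≠ v := fun e => hvU (e ▸ hs)
        simp [glue, huU, h, h1, h2]
      · simp [glue, huU, h]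

end

/-! ### A matching in the support, from Tutte's theorem -/

/-- If the support of `g` had a Tutte violator `X`, each odd component of the rest would send
weight at least `1` to `X`, whereas `X` receives only weight `#X` in total. -/
lemma IsFractionalMatching.exists_matchingMap_univ {W : Type*} [Fintype W] [DecidableEq W]
    {g : W → W → ℝ} (hg : IsFractionalMatching univ g) :
    ∃ σ : W → W, IsMatchingMap univ σ ∧ ∀ v, 0 < g v (σ v) := by
  classical
  let H : SimpleGraph W :=
    { Adj := fun u v => u ≠ v ∧ 0 < g u v
      symm := ⟨fun u v h => ⟨h.1.symm, hg.symm u v ▸ h.2⟩⟩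
      loopless := ⟨fun u h => h.1 rfl⟩ }
  have hT : ∀ X, ¬ H.IsTutteViolator X := by
    intro X hX
    rw [SimpleGraph.IsTutteViolator] at hX
    set K := ((⊤ : H.Subgraph).deleteVerts X).coe with hK
    let supp : K.ConnectedComponent → Finset W := fun C =>
      univ.filter fun w => ∃ h, K.connectedComponentMk ⟨w, h⟩ = C
    have hodd : ∀ C ∈ K.oddComponents, Odd #(supp C) := by
      intro C hC
      have : #(supp C) = C.supp.ncard := by
        rw [← Set.ncard_coe_finset, ← Set.ncard_image_of_injective C.supp Subtype.val_injective]
        congr 1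
        ext w
        simp [supp]
      rw [this]; exact hC
    have hcut : ∀ C ∈ K.oddComponents, 1 ≤ ∑ u ∈ supp C, ∑ v ∈ X.toFinset, g u v := by
      intro C hC
      refine (hg.cut (supp C) (subset_univ _) (hodd C hC)).trans ?_
      refine sum_le_sum fun u hu => ?_
      obtain ⟨hu', huC⟩ := (mem_filter.mp hu).2
      have h0 : ∀ v ∈ univ \ supp C, v ∉ X.toFinset → g u v = 0 := by
        intro v hv hvX
        by_contra hne
        have hv' : v ∉ X := by simpa using hvX
        refine (mem_sdiff.mp hv).2 (mem_filter.mpr ⟨mem_univ _, by simpa using hv', ?_⟩)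
        rw [← huC]
        refine SimpleGraph.ConnectedComponent.sound (SimpleGraph.Adj.reachable ?_)
        have huX : u ∉ X := by simpa using hu'
        have huv : v ≠ u := by
          rintro rfl; exact hne (hg.loop_eq_zero (mem_univ _))
        simp only [hK, SimpleGraph.Subgraph.coe_adj, SimpleGraph.Subgraph.deleteVerts_adj]
        refine ⟨by simp, hv', by simp, huX, huv, ?_⟩
        rw [hg.symm]
        exact lt_of_le_of_ne (hg.nonneg _ _) (Ne.symm hne)
      rw [← sum_filter_of_ne (p := fun v => v ∈ X.toFinset) fun v hv hne => by
        by_contra h; exact hne (h0 v hv h)]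
      exact sum_le_sum_of_subset_of_nonneg (fun v hv => (mem_filter.mp hv).2)
        fun v _ _ => hg.nonneg u v
    have hdisj :
        Set.PairwiseDisjoint (K.oddComponents.toFinset : Set K.ConnectedComponent) supp := by
      intro C _ D _ hne
      refine disjoint_left.mpr fun w hw hw' => hne ?_
      obtain ⟨h1, h2⟩ := (mem_filter.mp hw).2
      obtain ⟨h3, h4⟩ := (mem_filter.mp hw').2
      exact h2.symm.trans h4
    have h1 : (#K.oddComponents.toFinset : ℝ) ≤ #X.toFinset := by
      calc (#K.oddComponents.toFinset : ℝ)
          = ∑ C ∈ K.oddComponents.toFinset, (1 : ℝ) := by simp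
        _ ≤ ∑ C ∈ K.oddComponents.toFinset, ∑ u ∈ supp C, ∑ v ∈ X.toFinset, g u v :=
            sum_le_sum fun C hC => hcut C (Set.mem_toFinset.mp hC)
        _ = ∑ u ∈ K.oddComponents.toFinset.biUnion supp, ∑ v ∈ X.toFinset, g u v :=
            (sum_biUnion hdisj).symm
        _ ≤ ∑ u, ∑ v ∈ X.toFinset, g u v :=
            sum_le_sum_of_subset_of_nonneg (subset_univ _) fun u _ _ =>
              sum_nonneg fun v _ => hg.nonneg u v
        _ = ∑ v ∈ X.toFinset, ∑ u, g v u := by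
            rw [sum_comm]
            exact sum_congr rfl fun u _ => sum_congr rfl fun v _ => hg.symm _ _
        _ = #X.toFinset := by
            rw [sum_congr rfl fun v _ => hg.row v (mem_univ v)]; simp
    rw [Set.ncard_eq_toFinset_card', Set.ncard_eq_toFinset_card'] at hX
    exact absurd h1 (not_le.mpr (by exact_mod_cast hX))
  obtain ⟨M, hM⟩ := SimpleGraph.tutte.mpr hT
  choose σ hσ hσ' using SimpleGraph.Subgraph.isPerfectMatching_iff.mp hM
  refine ⟨σ, fun v _ => ⟨mem_univ _, (hσ v).ne.symm, (hσ' _ _ (hσ v).symm).symm⟩, fun v => ?_⟩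
  exact (M.adj_sub (hσ v)).2

lemma IsFractionalMatching.exists_matchingMap {V : Type*} [DecidableEq V] {S : Finset V}
    {f : V → V → ℝ} (hf : IsFractionalMatching S f) :
    ∃ σ : V → V, IsMatchingMap S σ ∧ ∀ v ∈ S, 0 < f v (σ v) := by
  have hg : IsFractionalMatching (univ : Finset S) fun u v => f u v := by
    refine ⟨fun u v => hf.nonneg _ _, fun u v => hf.symm _ _, fun u _ => ?_, fun W _ hW => ?_⟩
    · rw [← hf.row u u.2]
      exact sum_coe_sort S fun v => f u v
    · have h1 := hf.cut (W.map (Function.Embedding.subtype _)) (fun x hx => by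
        obtain ⟨y, -, rfl⟩ := mem_map.mp hx; exact y.2) (by rwa [card_map])
      have h2 : S \ W.map (Function.Embedding.subtype _) =
          (univ \ W).map (Function.Embedding.subtype _) := by
        ext x
        by_cases hx : x ∈ S <;> simp [hx]
      rw [h2] at h1
      simpa [cutWeight, sum_map] using h1
  obtain ⟨σ, hσ, hpos⟩ := hg.exists_matchingMap_univ
  refine ⟨fun v => if h : v ∈ S then σ ⟨v, h⟩ else v, fun v hv => ?_, fun v hv => ?_⟩
  · obtain ⟨-, h1, h2⟩ := hσ ⟨v, hv⟩ (mem_univ _)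
    refine ⟨by simp [hv], ?_, by simp [hv, h2]⟩
    simpa [hv, Subtype.ext_iff] using h1
  · simpa [hv] using hpos ⟨v, hv⟩

/-! ### Edmonds' perfect matching theorem -/

section

variable {V : Type*} [DecidableEq V] {S : Finset V} {f f' : V → V → ℝ} {σ : V → V}

/-- The edge weights on `S` of the perfect matching given by `σ`. -/
def matchingWeight (S : Finset V) (σ : V → V) (u v : V) : ℝ :=
  if u ∈ S ∧ v ∈ S ∧ σ u = v then 1 else 0

lemma matchingWeight_nonneg (u v : V) : 0 ≤ matchingWeight S σ u v := by
  unfold matchingWeight; split_ifs <;> simp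

lemma matchingWeight_partner (hσ : IsMatchingMap S σ) {v : V} (hv : v ∈ S) :
    matchingWeight S σ v (σ v) = 1 := by
  simp [matchingWeight, hv, (hσ v hv).1]

lemma matchingWeight_symm (hσ : IsMatchingMap S σ) (u v : V) :
    matchingWeight S σ u v = matchingWeight S σ v u := by
  unfold matchingWeight
  congr 1
  apply propext
  constructor
  · rintro ⟨hu, hv, h⟩; exact ⟨hv, hu, (hσ.apply_eq_iff hu hv).mp h⟩
  · rintro ⟨hv, hu, h⟩; exact ⟨hu, hv, (hσ.apply_eq_iff hv hu).mp h⟩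

lemma matchingWeight_row (hσ : IsMatchingMap S σ) {u : V} (hu : u ∈ S) :
    ∑ v ∈ S, matchingWeight S σ u v = 1 := by
  rw [sum_eq_single_of_mem (σ u) (hσ u hu).1, matchingWeight_partner hσ hu]
  intro v _ hv
  simp [matchingWeight, hv.symm]

lemma cutWeight_matchingWeight_le (hσ : IsMatchingMap S σ) {A B : Finset V} (hA : A ⊆ S)
    (hB : B ⊆ S) : cutWeight (matchingWeight S σ) A B ≤ #A := by
  calc cutWeight (matchingWeight S σ) A B
      ≤ ∑ u ∈ A, ∑ v ∈ S, matchingWeight S σ u v :=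
        sum_le_sum fun u _ => sum_le_sum_of_subset_of_nonneg hB
          fun v _ _ => matchingWeight_nonneg u v
    _ = #A := by rw [sum_congr rfl fun u hu => matchingWeight_row hσ (hA hu)]; simp

lemma IsMatchingMap.isMatchingCombination (hσ : IsMatchingMap S σ)
    (hf : ∀ u ∈ S, ∀ v ∈ S, f u v = matchingWeight S σ u v) : IsMatchingCombination S f := by
  refine ⟨Unit, inferInstance, fun _ => 1, fun _ => σ, by simp, by simp, fun _ => hσ, ?_⟩
  intro u hu v hv
  simp [hf u hu v hv, matchingWeight, hu, hv]

lemma IsMatchingCombination.of_segment (hf' : IsMatchingCombination S f') (hσ : IsMatchingMap S σ)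
    {t : ℝ} (ht0 : 0 ≤ t) (ht1 : t ≤ 1)
    (hf : ∀ u v, f u v = t * matchingWeight S σ u v + (1 - t) * f' u v) :
    IsMatchingCombination S f := by
  obtain ⟨ι, _, c, ρ, hc0, hc1, hρ, hcf⟩ := hf'
  refine ⟨Option ι, inferInstance, fun o => o.elim t fun i => (1 - t) * c i,
    fun o => o.elim σ ρ, ?_, ?_, ?_, ?_⟩
  · rintro (_ | i)
    · exact ht0
    · exact mul_nonneg (by linarith) (hc0 i)
  · simp [← mul_sum, hc1]
  · rintro (_ | i)
    · exact hσ
    · exact hρ i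
  · intro u hu v hv
    rw [hf, ← hcf u hu v hv, Fintype.sum_option, mul_sum]
    simp only [Option.elim, matchingWeight, hu, hv, true_and]
    exact congrArg _ (sum_congr rfl fun i _ => by by_cases h : ρ i u = v <;> simp [h])

/-- Moving along a ray until the first of finitely many linear constraints becomes tight. -/
lemma exists_maximal_step {α : Type*} (A : Finset α) (s r : α → ℝ) (hs : ∀ a ∈ A, 0 ≤ s a)
    (hr : ∃ a ∈ A, 0 < r a) :
    ∃ t, 0 ≤ t ∧ (∀ a ∈ A, t * r a ≤ s a) ∧ ∃ a ∈ A, 0 < r a ∧ s a = t * r a := by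
  obtain ⟨b, hb, hb'⟩ := hr
  obtain ⟨a, ha, hmin⟩ := exists_min_image (A.filter fun a => 0 < r a) (fun a => s a / r a)
    ⟨b, mem_filter.mpr ⟨hb, hb'⟩⟩
  obtain ⟨haA, har⟩ := mem_filter.mp ha
  have ht : 0 ≤ s a / r a := div_nonneg (hs a haA) har.le
  refine ⟨s a / r a, ht, fun x hx => ?_, a, haA, har, by field_simp⟩
  by_cases hxr : 0 < r x
  · exact (le_div_iff₀ hxr).mp (hmin x (mem_filter.mpr ⟨hx, hxr⟩))
  · exact (mul_nonpos_of_nonneg_of_nonpos ht (not_lt.mp hxr)).trans (hs x hx)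

lemma IsFractionalMatching.isMatchingCombination_of_tight (hf : IsFractionalMatching S f)
    {U : Finset V} (hU : U ⊆ S) (hodd : Odd #U) (htight : cutWeight f U (S \ U) = 1)
    (h1 : 1 < #U) (h2 : 1 < #(S \ U))
    (ih : ∀ T : Finset V, #T < #S → ∀ g : V → V → ℝ, IsFractionalMatching T g →
      IsMatchingCombination T g) :
    IsMatchingCombination S f := by
  obtain ⟨s, hs⟩ := card_pos.mp (by omega : 0 < #U)
  obtain ⟨r, hr⟩ := card_pos.mp (by omega : 0 < #(S \ U))
  have hcard := card_sdiff_add_card_eq_card hU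
  have hSU : S \ (S \ U) = U := Finset.sdiff_sdiff_eq_self hU
  have hodd' : Odd #(S \ U) := by
    obtain ⟨a, ha⟩ := hodd
    obtain ⟨b, hb⟩ := hf.even_card
    exact ⟨b - a - 1, by omega⟩
  refine .of_contract hf hU hr hs (ih _ ?_ _ (hf.contract hU hodd htight hr))
    (ih _ ?_ _ (hf.contract sdiff_subset hodd' ?_ (by rwa [hSU])))
  · exact (card_insert_le _ _).trans_lt (by omega)
  · exact (card_insert_le _ _).trans_lt (by omega)
  · rwa [hSU, cutWeight_comm hf.symm]

/-- **Edmonds' perfect matching theorem**: Edmonds' inequalities describe the convex hull of the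
perfect matchings. Subtract from `f` as large a multiple `t` of a matching in its support as the
inequalities allow. Then either the support shrinks, or an odd cut that the matching meets more than
once becomes tight; such a cut has at least two vertices on each side and can be contracted. -/
theorem IsFractionalMatching.isMatchingCombination (hf : IsFractionalMatching S f) :
    IsMatchingCombination S f := by
  induction hn : #S using Nat.strong_induction_on generalizing S f with
  | _ n ihn =>
  subst hn
  induction hk : #((S ×ˢ S).filter fun p => f p.1 p.2 ≠ 0) using Nat.strong_induction_on
    generalizing f with
  | _ k ihk =>
  subst hk
  obtain ⟨σ, hσ, hpos⟩ := hf.exists_matchingMap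
  rcases S.eq_empty_or_nonempty with rfl | ⟨w, hw⟩
  · exact hσ.isMatchingCombination (by simp)
  set m := matchingWeight S σ with hm
  have hms : ∀ u v, m u v = m v u := matchingWeight_symm hσ
  have hm0 : ∀ u v, 0 < m u v → u ∈ S ∧ v ∈ S ∧ 0 < f u v := by
    intro u v h
    simp only [hm, matchingWeight] at h
    split_ifs at h with h'
    · obtain ⟨hu, hv, rfl⟩ := h'
      exact ⟨hu, hv, hpos u hu⟩
    · exact absurd h (lt_irrefl _)
  obtain ⟨t, ht0, hle, a, ha, har, heq⟩ := exists_maximal_step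
    ((S ×ˢ S).disjSum (S.powerset.filter fun W => Odd #W))
    (Sum.elim (fun p => f p.1 p.2) fun W => cutWeight f W (S \ W) - 1)
    (Sum.elim (fun p => m p.1 p.2) fun W => cutWeight m W (S \ W) - 1)
    (by
      rintro (p | W) h
      · exact hf.nonneg _ _
      · simp only [inr_mem_disjSum, mem_filter, mem_powerset] at h
        simpa using hf.cut W h.1 h.2)
    ⟨Sum.inl (w, σ w), by simp [hw, (hσ w hw).1], by
      simp [hm, matchingWeight_partner hσ hw]⟩
  have hle1 : ∀ u ∈ S, ∀ v ∈ S, t * m u v ≤ f u v := fun u hu v hv => by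
    simpa using hle (Sum.inl (u, v)) (by simp [hu, hv])
  have hle2 : ∀ W ⊆ S, Odd #W → t * (cutWeight m W (S \ W) - 1) ≤ cutWeight f W (S \ W) - 1 :=
    fun W hW hWo => by simpa using hle (Sum.inr W) (by simp [hW, hWo])
  have ht1 : t ≤ 1 := by
    have h1 := hle1 w hw (σ w) (hσ w hw).1
    rw [hm, matchingWeight_partner hσ hw, mul_one] at h1
    exact h1.trans ((single_le_sum (fun v _ => hf.nonneg w v) (hσ w hw).1).trans_eq (hf.row w hw))
  rcases ht1.eq_or_lt with rfl | ht1
  · refine hσ.isMatchingCombination fun u hu v hv => ?_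
    have h := (sum_eq_sum_iff_of_le fun v hv => by simpa using hle1 u hu v hv).mp
      ((matchingWeight_row hσ hu).trans (hf.row u hu).symm)
    exact (h v hv).symm
  have h1t : 0 < 1 - t := by linarith
  set g : V → V → ℝ := fun u v => (f u v - t * m u v) / (1 - t) with hg
  have hcut : ∀ A B, cutWeight g A B = (cutWeight f A B - t * cutWeight m A B) / (1 - t) := by
    intro A B
    simp only [cutWeight, hg, ← sum_div, sum_sub_distrib, ← mul_sum]
  have hgf : IsFractionalMatching S g := by
    refine ⟨fun u v => div_nonneg ?_ h1t.le, fun u v => ?_, fun u hu => ?_, fun W hW hWo => ?_⟩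
    · by_cases h : 0 < m u v
      · obtain ⟨hu, hv, -⟩ := hm0 u v h
        linarith [hle1 u hu v hv]
      · have : m u v = 0 := le_antisymm (not_lt.mp h) (matchingWeight_nonneg u v)
        simpa [this] using hf.nonneg u v
    · simp only [hg, hf.symm u v, hms u v]
    · simp only [hg, ← sum_div, sum_sub_distrib, ← mul_sum]
      rw [hf.row u hu, matchingWeight_row hσ hu, mul_one, div_self h1t.ne']
    · rw [hcut, le_div_iff₀ h1t]
      linarith [hle2 W hW hWo]
  refine IsMatchingCombination.of_segment (f' := g) ?_ hσ ht0 ht1.le fun u v => by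
    simp only [hg]; field_simp; ring
  rcases a with ⟨u, v⟩ | W
  · -- The edge `uv` of the matching leaves the support.
    simp only [Sum.elim_inl] at har heq
    obtain ⟨hu, hv, hfuv⟩ := hm0 u v har
    refine ihk _ (card_lt_card ?_) hgf rfl
    refine ssubset_iff_of_subset ?_ |>.mpr ⟨(u, v), ?_, ?_⟩
    · intro p hp
      rw [mem_filter] at hp ⊢
      refine ⟨hp.1, fun h0 => hp.2 ?_⟩
      have : m p.1 p.2 = 0 := by
        by_contra h
        have := (hm0 p.1 p.2 (lt_of_le_of_ne (matchingWeight_nonneg _ _) (Ne.symm h))).2.2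
        exact this.ne' h0
      simp [hg, h0, this]
    · simp [hu, hv, hfuv.ne']
    · simp [hg, heq]
  · -- The odd cut of `W` becomes tight.
    simp only [Sum.elim_inr] at har heq
    simp only [inr_mem_disjSum, mem_filter, mem_powerset] at ha
    have hW1 := cutWeight_matchingWeight_le hσ ha.1 (sdiff_subset (s := S) (t := W))
    have hW2 := cutWeight_matchingWeight_le hσ (sdiff_subset (s := S) (t := W)) ha.1
    rw [cutWeight_comm (matchingWeight_symm hσ)] at hW2
    refine hgf.isMatchingCombination_of_tight ha.1 ha.2 ?_ ?_ ?_
      fun T hT g hg => ihn _ hT hg rfl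
    · rw [hcut, div_eq_one_iff_eq h1t.ne']
      linarith
    · exact_mod_cast (by linarith : (1 : ℝ) < #W)
    · exact_mod_cast (by linarith : (1 : ℝ) < #(S \ W))

end

/-! ### Cubic bridgeless graphs -/

lemma vertexPackingPolytope_nonneg {V : Type*} {G : SimpleGraph V} {a : V → ℝ}
    (ha : a ∈ vertexPackingPolytope G) : 0 ≤ a := by
  refine convexHull_min ?_ (convex_Ici (0 : V → ℝ)) ha
  rintro _ ⟨S, -, rfl⟩
  exact Set.indicator_nonneg fun _ _ => zero_le_one

lemma vertexPackingPolytope_le_one {V : Type*} {G : SimpleGraph V} {a : V → ℝ}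
    (ha : a ∈ vertexPackingPolytope G) : a ≤ 1 := by
  refine convexHull_min ?_ (convex_Iic (1 : V → ℝ)) ha
  rintro _ ⟨S, -, rfl⟩
  exact Set.indicator_le_self' fun _ _ => zero_le_one

/-- If the only edge between `W` and its complement is `uv`, then `uv` is a bridge. -/
lemma isBridge_of_unique_crossing {V : Type*} {G : SimpleGraph V} {W : Set V} {u v : V}
    (hu : u ∈ W) (hv : v ∉ W)
    (h : ∀ x ∈ W, ∀ y ∉ W, G.Adj x y → x = u ∧ y = v) : G.IsBridge s(u, v) := by
  rw [SimpleGraph.isBridge_iff]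
  rintro ⟨p⟩
  obtain ⟨d, -, hd1, hd2⟩ := p.exists_boundary_dart W hu hv
  have hadj := d.adj
  rw [SimpleGraph.deleteEdges_adj] at hadj
  obtain ⟨h1, h2⟩ := h _ hd1 _ hd2 hadj.1
  exact hadj.2 (by rw [h1, h2]; rfl)

/-- The edges of `G` that belong to the matching given by `σ`. -/
def matchingEdges {V : Type*} (G : SimpleGraph V) (σ : V → V) : Set G.edgeSet :=
  {e | ∀ v ∈ e.1, σ v ∈ e.1 ∧ σ v ≠ v}

lemma mem_matchingEdges {V : Type*} [Fintype V] {G : SimpleGraph V} {σ : V → V}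
    (hσ : IsMatchingMap univ σ) {u v : V} (h : s(u, v) ∈ G.edgeSet) :
    (⟨s(u, v), h⟩ : G.edgeSet) ∈ matchingEdges G σ ↔ σ u = v := by
  have hu := (hσ u (mem_univ _)).2
  have hv := (hσ v (mem_univ _)).2
  simp only [matchingEdges, Set.mem_ofPred_eq, Sym2.mem_iff]
  constructor
  · intro H
    exact (H u (Or.inl rfl)).1.resolve_left hu.1
  · rintro rfl x (rfl | rfl)
    · exact ⟨Or.inr rfl, hu.1⟩
    · exact ⟨Or.inl hu.2, hv.1⟩

lemma isIndepSet_matchingEdges {V : Type*} [Fintype V] {G : SimpleGraph V} {σ : V → V}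
    (hσ : IsMatchingMap univ σ) :
    G.lineGraph.IsIndepSet (matchingEdges G σ) := by
  rintro ⟨e, he⟩ heσ ⟨e', he'⟩ heσ' hne hadj
  obtain ⟨-, v, hv, hv'⟩ := SimpleGraph.lineGraph_adj_iff_exists.mp hadj
  obtain ⟨x, rfl⟩ := Sym2.mem_iff_exists.mp hv
  obtain ⟨y, rfl⟩ := Sym2.mem_iff_exists.mp hv'
  rw [mem_matchingEdges hσ] at heσ heσ'
  subst heσ
  exact hne (by simp [heσ'])

section

variable {V : Type*} [Fintype V] [DecidableEq V] {G : SimpleGraph V} [DecidableRel G.Adj]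

/-- In a graph all of whose degrees are odd, an odd set of vertices is left by an odd number of
edges. -/
lemma odd_card_crossing (hdeg : ∀ v, Odd (G.degree v)) {W : Finset V} (hW : Odd #W) :
    Odd (∑ u ∈ W, #{v ∈ Wᶜ | G.Adj u v}) := by
  have hsplit : ∀ u, G.degree u = #{v ∈ W | G.Adj u v} + #{v ∈ Wᶜ | G.Adj u v} := by
    intro u
    rw [← SimpleGraph.card_neighborFinset_eq_degree, SimpleGraph.neighborFinset_eq_filter,
      ← card_union_of_disjoint (disjoint_filter_filter disjoint_compl_right), ← filter_union,
      union_compl]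
  have hin : Even (∑ u ∈ W, #{v ∈ W | G.Adj u v}) := by
    have h := (G.induce (W : Set V)).sum_degrees_eq_twice_card_edges
    have h2 : ∀ u : (W : Set V), (G.induce (W : Set V)).degree u = #{v ∈ W | G.Adj u v} := by
      intro u
      rw [← SimpleGraph.card_neighborFinset_eq_degree, SimpleGraph.neighborFinset_eq_filter,
        ← card_map (Function.Embedding.subtype _)]
      congr 1
      ext x
      simp [and_comm]
    rw [sum_congr rfl fun u _ => h2 u] at h
    have h3 := sum_coe_sort W fun u => #{v ∈ W | G.Adj u v}
    rw [← h3]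
    exact ⟨_, (h.trans (two_mul _))⟩
  have htot : Odd (∑ u ∈ W, G.degree u) := by
    rw [odd_sum_iff_odd_card_odd]
    simpa [hdeg] using hW
  rw [sum_congr rfl fun u _ => hsplit u, sum_add_distrib] at htot
  exact (Nat.odd_add'.mp htot).mpr hin

/-- In a bridgeless cubic graph the weight `1 / 3` on every edge satisfies Edmonds' inequalities:
an odd cut has an odd number of edges, and a single edge would be a bridge. -/
lemma isFractionalMatching_third (hcubic : G.IsRegularOfDegree 3) (hb : IsBridgeless G) :
    IsFractionalMatching univ fun u v => if G.Adj u v then (1 / 3 : ℝ) else 0 := by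
  refine ⟨fun u v => by split_ifs <;> norm_num, fun u v => by simp [G.adj_comm], ?_, ?_⟩
  · intro u _
    rw [← sum_filter, ← SimpleGraph.neighborFinset_eq_filter]
    simp [hcubic u]
  · intro W _ hW
    have hodd := odd_card_crossing (G := G) (fun v => by rw [hcubic v]; decide) hW
    have hne : ∑ u ∈ W, #{v ∈ Wᶜ | G.Adj u v} ≠ 1 := by
      intro h1
      rw [← card_sigma] at h1
      obtain ⟨⟨u, v⟩, huv⟩ := card_eq_one.mp h1
      have hmem : ∀ x y, (x ∈ W ∧ y ∉ W ∧ G.Adj x y) ↔ x = u ∧ y = v := by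
        intro x y
        have := Finset.ext_iff.mp huv ⟨x, y⟩
        simpa [and_assoc] using this
      obtain ⟨hu, hv, hadj⟩ := (hmem u v).mpr ⟨rfl, rfl⟩
      refine hb s(u, v) hadj (
        isBridge_of_unique_crossing (W := (W : Set V)) hu (by simpa using hv) ?_)
      intro x hx y hy hxy
      exact (hmem x y).mp ⟨hx, by simpa using hy, hxy⟩
    have h3 : 3 ≤ ∑ u ∈ W, #{v ∈ Wᶜ | G.Adj u v} := by
      obtain ⟨a, ha⟩ := hodd; omega
    have h4 : cutWeight (fun u v => if G.Adj u v then (1 / 3 : ℝ) else 0) W (univ \ W) =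
        ((∑ u ∈ W, #{v ∈ Wᶜ | G.Adj u v} : ℕ) : ℝ) / 3 := by
      simp only [cutWeight, ← compl_eq_univ_sdiff, ← sum_filter, sum_const, nsmul_eq_mul]
      push_cast
      rw [sum_div]
      exact sum_congr rfl fun u _ => by ring
    rw [h4]
    have : (3 : ℝ) ≤ ((∑ u ∈ W, #{v ∈ Wᶜ | G.Adj u v} : ℕ) : ℝ) := by exact_mod_cast h3
    linarith

/-- The vector with all coordinates `1 / 3` lies in the matching polytope of a bridgeless cubic
graph. -/
lemma third_mem_vertexPackingPolytope (hcubic : G.IsRegularOfDegree 3) (hb : IsBridgeless G) :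
    (fun _ => 1 / 3 : G.edgeSet → ℝ) ∈ vertexPackingPolytope G.lineGraph := by
  obtain ⟨ι, _, c, σ, hc0, hc1, hσ, hcf⟩ :=
    (isFractionalMatching_third hcubic hb).isMatchingCombination
  have hsum : (fun _ => 1 / 3 : G.edgeSet → ℝ) =
      ∑ i, c i • (matchingEdges G (σ i)).indicator (1 : G.edgeSet → ℝ) := by
    classical
    ext ⟨e, he⟩
    induction e with | h u v =>
    have h1 := hcf u (mem_univ _) v (mem_univ _)
    simp only [if_pos (show G.Adj u v from he)] at h1
    rw [← h1, Finset.sum_apply]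
    refine sum_congr rfl fun i _ => ?_
    simp [Set.indicator_apply, mem_matchingEdges (hσ i)]
  rw [hsum]
  exact (convex_convexHull ℝ _).sum_mem (fun i _ => hc0 i) hc1 fun i _ =>
    subset_convexHull ℝ _ ⟨_, isIndepSet_matchingEdges (hσ i), rfl⟩

/-- A point of the matching polytope has total weight at most `1` at every vertex. -/
lemma sum_incident_le_one {a : G.edgeSet → ℝ} (ha : a ∈ vertexPackingPolytope G.lineGraph) (v : V) :
    ∑ e : G.edgeSet, (if v ∈ e.1 then a e else 0) ≤ 1 := by
  have hconv :
      Convex ℝ {a : G.edgeSet → ℝ | ∑ e : G.edgeSet, (if v ∈ e.1 then a e else 0) ≤ 1} := by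
    refine convex_halfSpace_le (f := fun a : G.edgeSet → ℝ =>
      ∑ e : G.edgeSet, (if v ∈ e.1 then a e else 0)) ⟨fun x y => ?_, fun r x => ?_⟩ 1
    · rw [← sum_add_distrib]
      exact sum_congr rfl fun e _ => by split_ifs <;> simp
    · rw [smul_eq_mul, mul_sum]
      exact sum_congr rfl fun e _ => by split_ifs <;> simp
  refine convexHull_min ?_ hconv ha
  classical
  rintro _ ⟨S, hS, rfl⟩
  have h1 : ∀ e : G.edgeSet, (if v ∈ e.1 then S.indicator (1 : G.edgeSet → ℝ) e else 0) =
      if v ∈ e.1 ∧ e ∈ S then 1 else 0 := by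
    intro e
    by_cases h : v ∈ e.1 <;> simp [h, Set.indicator_apply]
  rw [Set.mem_ofPred_eq, sum_congr rfl fun e _ => h1 e, sum_boole]
  have : #{e : G.edgeSet | v ∈ e.1 ∧ e ∈ S} ≤ 1 := by
    rw [card_le_one]
    intro e he e' he'
    simp only [mem_filter, mem_univ, true_and] at he he'
    by_contra hne
    exact hS he.2 he'.2 hne
      (SimpleGraph.lineGraph_adj_iff_exists.mpr ⟨hne, v, he.1, he'.1⟩)
  exact_mod_cast this

/-- A point of the matching polytope of a cubic graph has mean coordinate at most `1 / 3`. -/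
lemma three_mul_sum_le_card (hcubic : G.IsRegularOfDegree 3) {a : G.edgeSet → ℝ}
    (ha : a ∈ vertexPackingPolytope G.lineGraph) :
    3 * ∑ e, a e ≤ Fintype.card G.edgeSet := by
  have hends : ∀ e : G.edgeSet, #{v : V | v ∈ e.1} = 2 := by
    rintro ⟨e, he⟩
    induction e with | h u v =>
    have : ({x : V | x ∈ s(u, v)} : Finset V) = {u, v} := by ext; simp
    rw [this, card_pair (G.ne_of_adj he)]
  have h1 : ∑ v : V, ∑ e : G.edgeSet, (if v ∈ e.1 then a e else 0) = 2 * ∑ e, a e := by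
    rw [sum_comm, mul_sum]
    refine sum_congr rfl fun e _ => ?_
    rw [← sum_filter, sum_const, hends e]
    simp
  have h2 : ∑ v : V, ∑ e : G.edgeSet, (if v ∈ e.1 then a e else 0) ≤ Fintype.card V :=
    (sum_le_sum fun v _ => sum_incident_le_one ha v).trans_eq (by simp)
  have h3 := G.sum_degrees_eq_twice_card_edges
  rw [sum_congr rfl fun v _ => hcubic v] at h3
  simp only [sum_const, card_univ, smul_eq_mul] at h3
  have h4 : (Fintype.card V : ℝ) * 3 = 2 * (Fintype.card G.edgeSet : ℝ) := by
    rw [← SimpleGraph.edgeFinset_card]; exact_mod_cast h3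
  linarith

end

/-! ### Entropy -/

lemma logInv_nonneg {x : ℝ} (h0 : 0 ≤ x) (h1 : x ≤ 1) : 0 ≤ logInv x := by
  unfold logInv
  split_ifs with h
  · exact le_top
  · have hx : 0 < x := lt_of_le_of_ne h0 (Ne.symm h)
    exact_mod_cast Real.logb_nonneg one_lt_two ((one_le_div hx).mpr h1)

lemma ereal_coe_sum {ι : Type*} (s : Finset ι) (f : ι → ℝ) :
    ((∑ i ∈ s, f i : ℝ) : EReal) = ∑ i ∈ s, (f i : EReal) := by
  classical
  induction s using Finset.induction_on with
  | empty => simp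
  | insert a s ha ih => rw [sum_insert ha, sum_insert ha, EReal.coe_add, ih]

section

variable {V : Type*} [Fintype V] {G : SimpleGraph V}

lemma entropy_le_logb_three (h : (fun _ => 1 / 3 : V → ℝ) ∈ vertexPackingPolytope G) {p : V → ℝ}
    (hp : p ∈ stdSimplex ℝ V) : entropy G p ≤ (Real.logb 2 3 : ℝ) := by
  refine (iInf₂_le _ h).trans_eq ?_
  have h1 : ∀ v, (p v : EReal) * logInv (1 / 3) = ((p v * Real.logb 2 3 : ℝ) : EReal) := by
    intro v
    rw [logInv, if_neg (by norm_num), one_div_one_div, EReal.coe_mul]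
  rw [sum_congr rfl fun v _ => h1 v, ← ereal_coe_sum, ← sum_mul, hp.2, one_mul]

/-- By concavity of the logarithm; a point with a zero coordinate contributes `⊤`. -/
lemma logb_three_le_entropy_uniform [Nonempty V]
    (h : ∀ a ∈ vertexPackingPolytope G, 3 * ∑ v, a v ≤ Fintype.card V) :
    (Real.logb 2 3 : ℝ) ≤ entropy G (uniform V) := by
  refine le_iInf₂ fun a ha => ?_
  have hn : (0 : ℝ) < Fintype.card V := by exact_mod_cast Fintype.card_pos
  have ha0 : ∀ v, 0 ≤ a v := vertexPackingPolytope_nonneg ha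
  have hterm : ∀ v, 0 ≤ (uniform V v : EReal) * logInv (a v) := fun v =>
    mul_nonneg (by exact_mod_cast (one_div_pos.mpr hn).le)
      (logInv_nonneg (ha0 v) (vertexPackingPolytope_le_one ha v))
  by_cases hz : ∃ v, a v = 0
  · obtain ⟨v, hv⟩ := hz
    have h1 : (uniform V v : EReal) * logInv (a v) = ⊤ := by
      rw [logInv, if_pos hv]
      exact EReal.coe_mul_top_of_pos (one_div_pos.mpr hn)
    have h2 := single_le_sum (fun w _ => hterm w) (mem_univ v)
    rw [h1] at h2
    exact le_top.trans h2
  · push Not at hz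
    have hpos : ∀ v, 0 < a v := fun v => lt_of_le_of_ne (ha0 v) (Ne.symm (hz v))
    have h1 : ∀ v, (uniform V v : EReal) * logInv (a v) =
        (((1 / Fintype.card V : ℝ) * Real.logb 2 (1 / a v) : ℝ) : EReal) := by
      intro v
      rw [logInv, if_neg (hz v), EReal.coe_mul]; rfl
    rw [sum_congr rfl fun v _ => h1 v, ← ereal_coe_sum, EReal.coe_le_coe_iff]
    have hJ := strictConcaveOn_log_Ioi.concaveOn.le_map_sum (t := univ)
      (w := fun _ : V => (1 / Fintype.card V : ℝ)) (p := a) (fun _ _ => (one_div_pos.mpr hn).le)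
      (by simp [hn.ne']) (fun v _ => hpos v)
    simp only [smul_eq_mul, ← mul_sum] at hJ
    have hsum : 0 < ∑ v, a v := sum_pos (fun v _ => hpos v) univ_nonempty
    have hle : Real.log (1 / Fintype.card V * ∑ v, a v) ≤ Real.log (1 / 3) := by
      refine Real.log_le_log (by positivity) ?_
      rw [one_div_mul_eq_div, div_le_div_iff₀ hn (by norm_num)]
      linarith [h a ha]
    simp only [Real.logb, one_div, Real.log_inv] at hJ hle ⊢
    rw [← mul_sum, ← sum_div, sum_neg_distrib, mul_div_assoc']
    refine div_le_div_of_nonneg_right ?_ (Real.log_nonneg one_le_two)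
    linarith

end

end GraphEntropy

theorem mainTheorem5 {V : Type*} [Fintype V] [DecidableEq V] (G : SimpleGraph V)
    [DecidableRel G.Adj] (hcubic : G.IsRegularOfDegree 3)
    (hbridgeless : GraphEntropy.IsBridgeless G) :
    GraphEntropy.IsSymmetric G.lineGraph := by
  intro p hp
  -- A graph without edges has no probability density on its edges.
  have : Nonempty G.edgeSet := by
    by_contra h
    rw [not_nonempty_iff] at h
    simpa using hp.2
  exact (GraphEntropy.entropy_le_logb_three
    (GraphEntropy.third_mem_vertexPackingPolytope hcubic hbridgeless) hp).trans
    (GraphEntropy.logb_three_le_entropy_uniform fun a ha =>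
      GraphEntropy.three_mul_sum_le_card hcubic ha)
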